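/- All graphs are finite and simple. A graph is \emph{factorizable} if it has a perfect matching, and \emph{factor-critical} if deleting any single vertex leaves a factorizable graph (the graph with no vertices counts as factorizable, so a one-vertex graph is factor-critical). Let $G$ be a factorizable graph. An edge of $G$ is \emph{allowed} if it lies in some perfect matching of $G$. A \emph{factor-connected component} of $G$ is a subgraph $G[V(K)]$ where $K$ is a connected component of the subgraph of $G$ formed by all the allowed edges; let $\mathcal{G}(G)$ be the set of factor-connected components. A set $X\subseteq V(G)$ is \emph{separating} if every $H\in\mathcal{G}(G)$ satisfies $V(H)\subseteq X$ or $V(H)\cap X=\emptyset$. For $G_1,G_2\in\mathcal{G}(G)$ write $G_1\triangleleft G_2$ if there is a separating set $X\subseteq V(G)$ with $V(G_1)\cup V(G_2)\subseteq X$ such that the graph $G[X]/V(G_1)$, obtained from $G[X]$ by contracting every edge of $G[V(G_1)]$, is factor-critical. (It is known that $\triangleleft$ is a partial order on $\mathcal{G}(G)$.) For a graph $F$, let $D(F)$ be the set of vertices of $F$ that are left uncovered by some maximum matching of $F$, let $A(F)$ be the set of vertices of $V(F)\setminus D(F)$ that have a neighbor in $D(F)$, and let $C(F)=V(F)\setminus(D(F)\cup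 A(F))$ (the Gallai--Edmonds partition). \textbf{Theorem.} Let $G$ be a factorizable graph such that $(\mathcal{G}(G),\triangleleft)$ has a minimum element $G_0$, that is, $G_0\in\mathcal{G}(G)$ and $G_0\triangleleft H$ for every $H\in\mathcal{G}(G)$. Then $$V(G_0)=V(G)\setminus\bigcup_{x\in V(G)}C(G-x).$$ -/

import Mathlib

namespace SimpleGraph

variable {V : Type*}

/-- A graph is factorizable if it has a perfect matching. -/
def Factorizable (G : SimpleGraph V) : Prop :=
  ∃ M : G.Subgraph, M.IsPerfectMatching

/-- A graph is factor-critical if deleting any one vertex leaves a factorizable graph.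
In particular the one-vertex graph is factor-critical, since the graph without vertices has the
empty perfect matching. -/
def FactorCritical (G : SimpleGraph V) : Prop :=
  ∀ v : V, (G.induce {v}ᶜ).Factorizable

/-- The contraction `G / S`: every edge of `G[S]` is contracted. The vertices of `G / S` are the
connected components of the spanning subgraph of `G` whose edges are those of `G[S]` (so a vertex
outside `S` stays a vertex of its own, and `S` becomes one vertex when `G[S]` is connected), and
two different such vertices are adjacent when `G` has an edge between them. Loops are dropped and
parallel edges are merged, neither of which matters for matchings covering given vertices. -/
def contract (G : SimpleGraph V) (S : Set V) :
    SimpleGraph (G.induce S).spanningCoe.ConnectedComponent where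
  Adj a b := a ≠ b ∧ ∃ u ∈ a.supp, ∃ v ∈ b.supp, G.Adj u v
  symm := ⟨fun _ _ ⟨hne, u, hu, v, hv, h⟩ => ⟨hne.symm, v, hv, u, hu, h.symm⟩⟩
  loopless := ⟨fun _ h => h.1 rfl⟩

/-- The spanning subgraph of `G` whose edges are the allowed edges of `G`, that is, the edges that
lie in some perfect matching of `G`. -/
def allowedGraph (G : SimpleGraph V) : SimpleGraph V where
  Adj u v := ∃ M : G.Subgraph, M.IsPerfectMatching ∧ M.Adj u v
  symm := ⟨fun _ _ ⟨M, hM, h⟩ => ⟨M, hM, h.symm⟩⟩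
  loopless := ⟨fun _ ⟨_, _, h⟩ => h.ne rfl⟩

/-- The set of factor-connected components of `G` (used for factorizable `G`, where every vertex
lies on an allowed edge): the subgraphs of `G` induced by the vertex sets of the connected
components of the graph of allowed edges. -/
def factorComponents (G : SimpleGraph V) : Set G.Subgraph :=
  {H | ∃ K : G.allowedGraph.ConnectedComponent, H = (⊤ : G.Subgraph).induce K.supp}

/-- A vertex set is separating if every factor-connected component lies inside it or avoids it. -/
def IsSeparating (G : SimpleGraph V) (X : Set V) : Prop :=
  ∀ H ∈ G.factorComponents, H.verts ⊆ X ∨ H.verts ∩ X = ∅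

/-- The relation on factor-connected components: `G₁` yields `G₂` if some separating set `X`
contains the vertices of both and `G[X] / V(G₁)` is factor-critical. -/
def Yields (G : SimpleGraph V) (G₁ G₂ : G.Subgraph) : Prop :=
  ∃ X : Set V, G.IsSeparating X ∧ G₁.verts ∪ G₂.verts ⊆ X ∧
    ((G.induce X).contract ((↑) ⁻¹' G₁.verts)).FactorCritical

/-- `M` is a matching of the finite graph `G` with the largest possible number of edges. -/
def IsMaximumMatching (G : SimpleGraph V) (M : G.Subgraph) : Prop :=
  M.IsMatching ∧ ∀ M' : G.Subgraph, M'.IsMatching → M'.edgeSet.ncard ≤ M.edgeSet.ncard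

/-- `D(G)`: the vertices exposed by some maximum matching. -/
def gallaiEdmondsD (G : SimpleGraph V) : Set V :=
  {v | ∃ M : G.Subgraph, G.IsMaximumMatching M ∧ v ∉ M.verts}

/-- `A(G)`: the vertices outside `D(G)` with a neighbor in `D(G)`. -/
def gallaiEdmondsA (G : SimpleGraph V) : Set V :=
  {v | v ∉ G.gallaiEdmondsD ∧ ∃ w ∈ G.gallaiEdmondsD, G.Adj v w}

/-- `C(G)`: the vertices in neither `D(G)` nor `A(G)`. -/
def gallaiEdmondsC (G : SimpleGraph V) : Set V :=
  (G.gallaiEdmondsD ∪ G.gallaiEdmondsA)ᶜ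

end SimpleGraph

/-!
Fix a perfect matching `m` of `G` and call distinct vertices `x`, `y` of a vertex set `U` jointly
exposable in `U` if `G[U] - x - y` has a perfect matching. With `U` the whole vertex set, this says
`y ∈ D(G - x)`, so `v ∈ C(G - x)` means that `v ≠ x` and that neither `v` nor any neighbor of `v`
is jointly exposable with `x` (`mem_image_gallaiEdmondsC_iff`). The only tool is the path that
alternates between `m` and a second matching, starting at a vertex the second matching misses
(`IsPartnerMap.exists_alternatingSet`); it is recorded through its vertex set and the perfect
matchings obtained by cutting it.

Let `K` be the vertex set of the minimum component. Factor-criticality of the contractions says that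
from every vertex `u` outside `K` an alternating path reaches `K` with all its earlier vertices
outside `K` (`criticalOver_compl_supp`).

Vertices of `K` lie in no `C(G - x)`. If `x ∈ K`, being jointly exposable with `x` or adjacent to
such a vertex spreads along allowed edges (`jointlyExposable_or_adj_of_reachable`). If `x ∉ K`, an
alternating path from `x` enters `K` at some `g`, and the same argument applies inside `K` from `g`.

Conversely, let `v ∉ K`, let `L` be the connected component of `v` in `G - K`, and let `x ∈ K` be a
neighbor of `L`. Then `v ∈ C(G - x)`. Indeed, an alternating path from `x` to `L` or to another
neighbor of `L` in `K` would, up to its first visit to `L`, show that two neighbors of `L` in `K`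
are jointly exposable in `G - L`. This is impossible
(`not_jointlyExposable_of_adj_reachableOutside`). On `K`, not being jointly exposable in `G - L` is
an equivalence relation (`not_jointlyExposable_trans`). If the neighbors of `L` met both the class
`S` of `x` and the rest `T` of `K`, then some path through `L` would join `S` to `T` in such a way
that `m` matches the other vertices of `L` (`CriticalOver.exists_split`). Together with a perfect
matching of `G - L` minus the two ends, this gives a perfect matching of `G` using an edge between
`K` and `L`, although no allowed edge leaves `K`.
-/

namespace SimpleGraph

/-! ### Perfect matchings on vertex sets and alternating paths -/

/-- `G.MatchableOn S`: the induced subgraph `G[S]` has a perfect matching, encoded by a map that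
restricts to an involution of `S` sending each vertex to a neighbor. The values of the map outside
`S` are irrelevant. -/
def MatchableOn {V : Type*} (G : SimpleGraph V) (S : Set V) : Prop :=
  ∃ f : V → V, ∀ v ∈ S, f v ∈ S ∧ G.Adj v (f v) ∧ f (f v) = v

/-- A perfect matching of `G`, encoded by the involution sending each vertex to its partner. -/
def IsPartnerMap {V : Type*} (G : SimpleGraph V) (m : V → V) : Prop :=
  ∀ v, G.Adj v (m v) ∧ m (m v) = v

/-- `x` and `y` are distinct and `G[U] - x - y` has a perfect matching. -/
def JointlyExposable {V : Type*} (G : SimpleGraph V) (U : Set V) (x y : V) : Prop :=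
  x ≠ y ∧ G.MatchableOn (U \ {x, y})

section Paths

variable {V : Type*} {G : SimpleGraph V} {m : V → V}

theorem matchableOn_empty : G.MatchableOn ∅ := ⟨id, by simp⟩

theorem matchableOn_pair {a b : V} (h : G.Adj a b) : G.MatchableOn {a, b} := by
  classical
  refine ⟨fun v => if v = a then b else a, fun v hv => ?_⟩
  have := h.ne
  have := h.symm
  grind

theorem MatchableOn.congr {S T : Set V} (h : G.MatchableOn S) (e : ∀ a, a ∈ T ↔ a ∈ S) :
    G.MatchableOn T := (Set.ext e : T = S) ▸ h

/-- Perfect matchings of two disjoint parts combine to one of the whole. -/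
theorem MatchableOn.union {A B C : Set V} (hA : G.MatchableOn A) (hB : G.MatchableOn B)
    (hd : ∀ a ∈ A, a ∉ B) (hC : ∀ a, a ∈ C ↔ a ∈ A ∨ a ∈ B) : G.MatchableOn C := by
  classical
  obtain ⟨f, hf⟩ := hA
  obtain ⟨g, hg⟩ := hB
  refine ⟨fun v => if v ∈ A then f v else g v, fun v hv => ?_⟩
  have := hf v
  have := hg v
  have := hC v
  have := hC (f v)
  have := hC (g v)
  have := hd v
  have := hd (g v)
  grind

theorem IsPartnerMap.matchableOn (hm : G.IsPartnerMap m) {S : Set V} (hS : ∀ v ∈ S, m v ∈ S) :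
    G.MatchableOn S :=
  ⟨m, fun v hv => ⟨hS v hv, hm v⟩⟩

theorem JointlyExposable.symm {U : Set V} {x y : V} (h : G.JointlyExposable U x y) :
    G.JointlyExposable U y x :=
  ⟨h.1.symm, h.2.congr (by grind)⟩

theorem IsPartnerMap.jointlyExposable (hm : G.IsPartnerMap m) {U : Set V}
    (hU : ∀ v ∈ U, m v ∈ U) (x : V) : G.JointlyExposable U x (m x) := by
  refine ⟨(hm x).1.ne, hm.matchableOn fun v hv => ?_⟩
  have := hU v
  have := hm v
  have := hm x
  grind

/-- What is needed of the vertex set `W` of an `m`-alternating path from `x` to `z` whose first and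
last edges belong to the matching `m`. Cutting the path at the matching edge between `r` and `m r`
leaves two pieces, and matching each piece either by `m` or by the other edges of the path exposes
one end of the cut edge together with one end of the path. Which end of the cut edge goes with
which end of the path depends on the direction in which the path runs through that edge. -/
structure AlternatingSet (G : SimpleGraph V) (m : V → V) (W : Set V) (x z : V) : Prop where
  left_mem : x ∈ W
  right_mem : z ∈ W
  closed : ∀ v ∈ W, m v ∈ W
  split : ∀ r ∈ W, (G.JointlyExposable W r x ∧ G.JointlyExposable W (m r) z) ∨
    (G.JointlyExposable W r z ∧ G.JointlyExposable W (m r) x)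

theorem AlternatingSet.ends {W : Set V} {x z : V} (h : G.AlternatingSet m W x z) :
    G.JointlyExposable W x z := by
  rcases h.split x h.left_mem with h' | h'
  · exact absurd rfl h'.1.1
  · exact h'.1

theorem IsPartnerMap.alternatingSet_pair (hm : G.IsPartnerMap m) (x : V) :
    G.AlternatingSet m {x, m x} x (m x) := by
  have hx := hm x
  have hne := hx.1.ne
  have h : G.JointlyExposable {x, m x} x (m x) := ⟨hne, matchableOn_empty.congr (by simp)⟩
  refine ⟨by simp, by simp, by grind, fun r hr => ?_⟩
  have := h.symm
  grind

theorem AlternatingSet.extend (hm : G.IsPartnerMap m) {W : Set V} {x z p : V}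
    (h : G.AlternatingSet m W x z) (hp : p ∉ W) (hzp : G.Adj z p) :
    G.AlternatingSet m (W ∪ {p, m p}) x (m p) := by
  have hmp : m p ∉ W := fun h' => hp (by have := h.closed _ h'; rwa [(hm p).2] at this)
  have hne := (hm p).1.ne
  have hx := h.left_mem
  have hz := h.right_mem
  have hmm := (hm p).2
  have hcl := h.closed
  have hright : ∀ q ∈ W, G.JointlyExposable W q z →
      G.JointlyExposable (W ∪ {p, m p}) q (m p) := fun q hq hqz => by
    have := hqz.1
    exact ⟨by grind, hqz.2.union (matchableOn_pair hzp) (by grind) (by grind)⟩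
  have hleft : ∀ q ∈ W, G.JointlyExposable W q x →
      G.JointlyExposable (W ∪ {p, m p}) q x := fun q hq hqx => by
    have := hqx.1
    exact ⟨by grind, hqx.2.union (matchableOn_pair (hm p).1) (by grind) (by grind)⟩
  have hnew := (hright x hx h.ends).symm
  have hp' : G.JointlyExposable (W ∪ {p, m p}) p (m p) :=
    ⟨hne, (hm.matchableOn hcl).congr (by grind)⟩
  refine ⟨.inl hx, by grind, by grind, fun r hr => ?_⟩
  rcases hr with hr | rfl | rfl
  · exact (h.split r hr).imp (fun h' => ⟨hleft _ hr h'.1, hright _ (hcl r hr) h'.2⟩)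
      (fun h' => ⟨hright _ hr h'.1, hleft _ (hcl r hr) h'.2⟩)
  · exact .inr ⟨hp', hnew⟩
  · exact .inl ⟨hnew, hmm.symm ▸ hp'⟩

/-- Follow the alternating path that starts at `x` with an edge of the perfect matching `m` and
takes its other edges from a matching of `G[Z]`, where `x ∉ Z`. In a set `U` that `m` matches, this
path can only stop at a vertex which the second matching does not cover, or whose partner in the
second matching lies outside `U`. -/
theorem IsPartnerMap.exists_alternatingSet [Finite V] (hm : G.IsPartnerMap m) {U Z : Set V}
    (hU : ∀ v ∈ U, m v ∈ U) (hZ : G.MatchableOn Z) {x : V} (hx : x ∈ U) (hxZ : x ∉ Z) :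
    ∃ z ∈ U, z ≠ x ∧ (z ∉ Z ∨ ∃ r ∈ Z, r ∉ U ∧ G.Adj z r) ∧
      ∃ W ⊆ U, G.AlternatingSet m W x z := by
  obtain ⟨n, hn⟩ := hZ
  -- The invariant: the second matching pairs up the inner vertices of the path.
  have key : ∀ k : ℕ, ∀ W ⊆ U, ∀ z, Wᶜ.ncard = k → G.AlternatingSet m W x z →
      (∀ a ∈ W \ {x, z}, a ∈ Z ∧ n a ∈ W \ {x, z}) →
      ∃ z ∈ U, z ≠ x ∧ (z ∉ Z ∨ ∃ r ∈ Z, r ∉ U ∧ G.Adj z r) ∧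
        ∃ W ⊆ U, G.AlternatingSet m W x z := by
    intro k
    induction k using Nat.strong_induction_on with
    | _ k ih =>
      intro W hWU z hk hW hcl
      have hz := hW.right_mem
      have hxz := hW.ends.1
      by_cases hzZ : z ∈ Z
      · obtain ⟨hnz, hadj, hnn⟩ := hn z hzZ
        by_cases hnU : n z ∈ U
        · have hp : n z ∉ W := by
            intro h
            have := hcl (n z)
            have := hadj.ne
            grind
          have hmp : m (n z) ∉ W := fun h' =>
            hp (by have := hW.closed _ h'; rwa [(hm (n z)).2] at this)
          refine ih _ ?_ (W ∪ {n z, m (n z)}) ?_ (m (n z)) rfl (hW.extend hm hp hadj) ?_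
          · rw [← hk]
            exact Set.ncard_lt_ncard ⟨by grind, fun h => (h hp) (by simp)⟩ (Set.toFinite _)
          · have := hU (n z) hnU
            grind
          · have := (hm (n z)).1.ne
            have := hW.left_mem
            intro a ha
            have := hcl a
            grind
        · exact ⟨z, hWU hz, hxz.symm, .inr ⟨n z, hnz, hnU, hadj⟩, W, hWU, hW⟩
      · exact ⟨z, hWU hz, hxz.symm, .inl hzZ, W, hWU, hW⟩
  exact key _ {x, m x} (by have := hU x hx; grind) (m x) rfl (hm.alternatingSet_pair x) (by grind)

/-- Joint exposability passes from `W` to a larger set `U`, since `m` matches `U \ W`. -/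
theorem JointlyExposable.mono (hm : G.IsPartnerMap m) {U W : Set V} (hU : ∀ v ∈ U, m v ∈ U)
    (hW : ∀ v ∈ W, m v ∈ W) (hWU : W ⊆ U) {a b : V} (ha : a ∈ W) (hb : b ∈ W)
    (h : G.JointlyExposable W a b) : G.JointlyExposable U a b := by
  refine ⟨h.1, h.2.union (B := U \ W) (hm.matchableOn fun v hv => ?_) (by grind) (by grind)⟩
  have := hW (m v)
  have := hm v
  have := hU v
  grind

/-- Two disjoint sets joined by the edge `a r`: what is exposed together with the two ends of that
edge becomes jointly exposable in the union. -/
theorem JointlyExposable.splice {A B : Set V} {p a r q : V} (hA : G.JointlyExposable A p a)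
    (hB : G.JointlyExposable B r q) (hd : ∀ v ∈ A, v ∉ B) (hp : p ∈ A) (ha : a ∈ A) (hr : r ∈ B)
    (hq : q ∈ B) (har : G.Adj a r) : G.JointlyExposable (A ∪ B) p q := by
  have := hA.1
  have := hB.1
  refine ⟨by grind, (hA.2.union (matchableOn_pair har) (C := (A ∪ {r}) \ {p}) ?_ ?_).union
    hB.2 ?_ ?_⟩
  all_goals grind

/-- If `x` and `w` are jointly exposable and `a` is a neighbor of `w`, then the alternating path
from `x` to `w` yields one ending at `a` or at the partner of `a`. -/
theorem JointlyExposable.of_adj [Finite V] (hm : G.IsPartnerMap m) {U : Set V}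
    (hU : ∀ v ∈ U, m v ∈ U) {x w a : V} (hx : x ∈ U) (h : G.JointlyExposable U x w)
    (ha : a ∈ U) (haw : G.Adj a w) (hax : a ≠ x) :
    G.JointlyExposable U x a ∨ G.JointlyExposable U x (m a) := by
  obtain ⟨z, hzU, hzx, hz, W, hWU, hW⟩ := hm.exists_alternatingSet hU h.2 hx (by simp)
  obtain rfl : z = w := by grind
  by_cases haW : a ∈ W
  · have hl := hW.left_mem
    rcases hW.split a haW with h' | h'
    · exact .inl (h'.1.mono hm hU hW.closed hWU haW hl).symm
    · exact .inr (h'.2.mono hm hU hW.closed hWU (hW.closed a haW) hl).symm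
  · have hmaW : m a ∉ W := fun h' => haW (by have := hW.closed _ h'; rwa [(hm a).2] at this)
    have hl := hW.left_mem
    have hr := hW.right_mem
    have hne := (hm a).1.ne
    have hma := hU a ha
    have hmaa := (hm a).2
    refine .inr ⟨by grind, ?_⟩
    refine (hW.ends.2.union (matchableOn_pair haw) (C := (W ∪ {a}) \ {x}) ?_ ?_).union
      (B := U \ (W ∪ {a, m a})) (hm.matchableOn fun v hv => ?_) ?_ ?_
    · grind
    · have := hW.ends.1
      grind
    · have := hW.closed (m v)
      have := hm v
      have := hU v
      grind
    · grind
    · grind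

end Paths

/-! ### Joint exposability along allowed edges -/

section Components

variable {V : Type*} {G : SimpleGraph V} {m : V → V}

theorem Subgraph.IsPerfectMatching.exists_isPartnerMap {M : G.Subgraph}
    (hM : M.IsPerfectMatching) : ∃ m, G.IsPartnerMap m ∧ ∀ v, M.Adj v (m v) := by
  rw [Subgraph.isPerfectMatching_iff] at hM
  choose m hm using fun v => (hM v).exists
  exact ⟨m, fun v => ⟨(hm v).adj_sub, ((hM (m v)).unique (hm v).symm (hm (m v))).symm⟩, hm⟩

theorem IsPartnerMap.exists_isPerfectMatching (hm : G.IsPartnerMap m) :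
    ∃ M : G.Subgraph, M.IsPerfectMatching ∧ ∀ v, M.Adj v (m v) := by
  refine ⟨⟨Set.univ, fun u v => m u = v, fun {u v} h => h ▸ (hm u).1, fun _ => trivial,
    ⟨fun u v h => h ▸ (hm u).2⟩⟩, ?_, fun v => rfl⟩
  rw [Subgraph.isPerfectMatching_iff]
  exact fun v => ⟨m v, rfl, fun _ h => Eq.symm h⟩

theorem factorizable_iff_exists_isPartnerMap : G.Factorizable ↔ ∃ m, G.IsPartnerMap m :=
  ⟨fun ⟨_, hM⟩ => let ⟨m, hm, _⟩ := hM.exists_isPartnerMap; ⟨m, hm⟩,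
    fun ⟨_, hm⟩ => let ⟨M, hM, _⟩ := hm.exists_isPerfectMatching; ⟨M, hM⟩⟩

theorem allowedGraph_adj_iff {u v : V} :
    G.allowedGraph.Adj u v ↔ ∃ m, G.IsPartnerMap m ∧ m u = v := by
  constructor
  · rintro ⟨M, hM, h⟩
    obtain ⟨m, hm, hmM⟩ := hM.exists_isPartnerMap
    exact ⟨m, hm, hM.1.eq_of_adj_left (hmM u) h⟩
  · rintro ⟨m, hm, rfl⟩
    obtain ⟨M, hM, hmM⟩ := hm.exists_isPerfectMatching
    exact ⟨M, hM, hmM u⟩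

/-- Inside a set that all perfect matchings of `G` match, every vertex that can be reached from `x`
along allowed edges is jointly exposable with `x` or adjacent to such a vertex. The property spreads
along an allowed edge `v v'`: if `v` is jointly exposable with `x`, then `v'` is adjacent to such a
vertex; otherwise `v` is adjacent to one, and a perfect matching through `v v'` shows that `v'` is
jointly exposable with `x`. -/
theorem jointlyExposable_or_adj_of_reachable [Finite V] (hG : G.Factorizable) {U : Set V}
    (hU : ∀ m, G.IsPartnerMap m → ∀ v ∈ U, m v ∈ U) {x v : V} (hx : x ∈ U)
    (h : G.allowedGraph.Reachable x v) :
    v ∈ U ∧ (G.JointlyExposable U x v ∨ ∃ w ∈ U, G.Adj v w ∧ G.JointlyExposable U x w) := by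
  rw [reachable_iff_reflTransGen] at h
  induction h with
  | refl =>
    obtain ⟨m, hm⟩ := factorizable_iff_exists_isPartnerMap.1 hG
    exact ⟨hx, .inr ⟨m x, hU m hm x hx, (hm x).1, hm.jointlyExposable (hU m hm) x⟩⟩
  | @tail b c _ hbc ih =>
    obtain ⟨m, hm, rfl⟩ := allowedGraph_adj_iff.1 hbc
    obtain ⟨hb, ih⟩ := ih
    refine ⟨hU m hm b hb, ?_⟩
    by_cases hxb : G.JointlyExposable U x b
    · exact .inr ⟨b, hb, (hm b).1.symm, hxb⟩
    · obtain ⟨w, hw, hbw, hxw⟩ := ih.resolve_left hxb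
      by_cases hbx : b = x
      · exact .inl (hbx ▸ hm.jointlyExposable (hU m hm) b)
      · exact .inl ((hxw.of_adj hm (hU m hm) hx hb hbw hbx).resolve_left hxb)

/-- Within one factor-connected component, not being jointly exposable is transitive. If `x` and `z`
are jointly exposable but neither is with `y`, then `y` lies off the alternating path from `x` to
`z`. There is an alternating path from `y` ending with the matching edge at `x`; the point where it
first meets the path from `x` to `z` can be continued along that path to `x` or to `z`. -/
theorem not_jointlyExposable_trans [Finite V] (hG : G.Factorizable) {U : Set V}
    (hU : ∀ m, G.IsPartnerMap m → ∀ v ∈ U, m v ∈ U) {x y z : V} (hx : x ∈ U) (hy : y ∈ U)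
    (h : G.allowedGraph.Reachable y x) (hxy : ¬ G.JointlyExposable U x y)
    (hyz : ¬ G.JointlyExposable U y z) : ¬ G.JointlyExposable U x z := by
  intro hxz
  by_cases hxy' : x = y
  · exact hyz (hxy' ▸ hxz)
  obtain ⟨m, hm⟩ := factorizable_iff_exists_isPartnerMap.1 hG
  have hmU := hU m hm
  obtain ⟨z', hzU, hzx, hz, W, hWU, hW⟩ := hm.exists_alternatingSet hmU hxz.2 hx (by simp)
  obtain rfl : z' = z := by grind
  have hl := hW.left_mem
  have hr := hW.right_mem
  have hyW : y ∉ W := by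
    intro hyW
    rcases hW.split y hyW with h' | h'
    · exact hxy (h'.1.mono hm hmU hW.closed hWU hyW hl).symm
    · exact hyz (h'.1.mono hm hmU hW.closed hWU hyW hr)
  obtain ⟨w, hw, hxw, hyw⟩ := (jointlyExposable_or_adj_of_reachable hG hU hy h).2.resolve_left
    fun h' => hxy h'.symm
  have hymx := (hyw.of_adj hm hmU hy hx hxw hxy').resolve_left fun h' => hxy h'.symm
  have hmW := hW.closed
  have hmm := fun v => (hm v).2
  obtain ⟨a, haU, hay, ha, W', hWU', hW'⟩ := hm.exists_alternatingSet (U := U \ W)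
    (fun v hv => ⟨hmU v hv.1, fun h' => hv.2 (hmm v ▸ hmW _ h')⟩) hymx.2 ⟨hy, hyW⟩ (by simp)
  obtain ⟨r, hrU, hrW, har⟩ : ∃ r ∈ U, r ∈ W ∧ G.Adj a r := by
    have := hmW x hl
    grind
  have key : ∀ q ∈ W, G.JointlyExposable W r q → G.JointlyExposable U y q := fun q hq hrq =>
    (hW'.ends.splice hrq (fun v hv => (hWU' hv).2) hW'.left_mem hW'.right_mem hrW hq har).mono hm
      hmU (fun v hv => hv.imp (hW'.closed v) (hmW v))
      (Set.union_subset (fun v hv => (hWU' hv).1) hWU) (.inl hW'.left_mem) (.inr hq)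
  rcases hW.split r hrW with h' | h'
  · exact hxy (key x hl h'.1).symm
  · exact hyz (key z' hr h'.1)

end Components

/-! ### Critical sets and ears -/

section Coloring

variable {V : Type*} {G : SimpleGraph V} {m : V → V}

/-- The matching `m` matches `X` within itself, and for each `u ∈ X` there is a vertex `p ≠ u` of `X`
with a neighbor in `S` such that `G[X] - u - p` has a perfect matching. When `S` is nonempty and
disjoint from `X`, this says that identifying the vertices of `S` in `G[X ∪ S]` yields a graph all
of whose vertex-deleted subgraphs have perfect matchings. -/
structure CriticalOver (G : SimpleGraph V) (m : V → V) (S X : Set V) : Prop where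
  closed : ∀ v ∈ X, m v ∈ X
  exists_exit : ∀ u ∈ X, ∃ p ∈ X, ∃ s ∈ S, G.Adj s p ∧ G.JointlyExposable X u p

/-- Some `p` in `X ∪ {e}` has a neighbor in `S`, and the rest of `X ∪ {e}` has a perfect matching.
This is how an alternating path that reaches `e` from outside `X` gets on to `S`: directly, or
through `X`. -/
def Attached (G : SimpleGraph V) (S X : Set V) (e : V) : Prop :=
  ∃ p ∈ insert e X, (∃ s ∈ S, G.Adj s p) ∧ G.MatchableOn (insert e X \ {p})

theorem CriticalOver.attached (hm : G.IsPartnerMap m) {S X : Set V}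
    (hX : G.CriticalOver m S X) {e : V} (he : e ∉ X) (h : ∃ r, (r ∈ S ∨ r ∈ X) ∧ G.Adj r e) :
    G.Attached S X e := by
  obtain ⟨r, hr | hr, hre⟩ := h
  · exact ⟨e, by simp, ⟨r, hr, hre⟩, (hm.matchableOn hX.closed).congr (by grind)⟩
  · obtain ⟨p, hp, s, hs, hsp, hrp⟩ := hX.exists_exit r hr
    have := hrp.1
    exact ⟨p, by grind, ⟨s, hs, hsp⟩,
      hrp.2.union (matchableOn_pair hre) (by grind) (by grind)⟩

/-- Adding an ear to a critical set: an alternating path outside `X` both of whose ends attach to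
`X` through `S` can be added to `X`. -/
theorem CriticalOver.union_alternatingSet (hm : G.IsPartnerMap m) {S X W : Set V} {e e' : V}
    (hX : G.CriticalOver m S X) (hW : G.AlternatingSet m W e e') (hWX : ∀ v ∈ W, v ∉ X)
    (he : G.Attached S X e) (he' : G.Attached S X e') : G.CriticalOver m S (X ∪ W) := by
  have hl := hW.left_mem
  have hr := hW.right_mem
  -- A path segment from `u` to an attached end continues through the attachment.
  have key : ∀ u ∈ W, ∀ d ∈ W, G.Attached S X d → G.JointlyExposable W u d →
      ∃ p ∈ X ∪ W, ∃ s ∈ S, G.Adj s p ∧ G.JointlyExposable (X ∪ W) u p := by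
    rintro u hu d hd ⟨p, hp, ⟨s, hs, hsp⟩, hpm⟩ hud
    have := hud.1
    exact ⟨p, by grind, s, hs, hsp, by grind, hpm.union hud.2 (by grind) (by grind)⟩
  have hXc := hX.closed
  have hWc := hW.closed
  refine ⟨by grind, ?_⟩
  rintro u (hu | hu)
  · obtain ⟨p, hp, s, hs, hsp, hup⟩ := hX.exists_exit u hu
    exact ⟨p, .inl hp, s, hs, hsp, hup.mono hm (by grind) hXc (by grind) hu hp⟩
  · rcases hW.split u hu with h | h
    · exact key u hu e hl he h.1
    · exact key u hu e' hr he' h.1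

/-- Two distinct vertices of `K`, one with a neighbor in `S` and one with a neighbor in `T`, can be
removed so that the rest of `G[K]` has a perfect matching. When `G[K]` itself has one, this amounts
to an ear through `K` from `S` to `T`. -/
def HasEar (G : SimpleGraph V) (S T K : Set V) : Prop :=
  ∃ p ∈ K, ∃ q ∈ K, (∃ s ∈ S, G.Adj s p) ∧ (∃ t ∈ T, G.Adj t q) ∧ G.JointlyExposable K p q

theorem HasEar.mono (hm : G.IsPartnerMap m) {S T K L : Set V} (hK : ∀ v ∈ K, m v ∈ K)
    (hL : ∀ v ∈ L, m v ∈ L) (hKL : K ⊆ L) (h : G.HasEar S T K) : G.HasEar S T L := by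
  obtain ⟨p, hp, q, hq, hs, ht, hpq⟩ := h
  exact ⟨p, hKL hp, q, hKL hq, hs, ht, hpq.mono hm hL hK hKL hp hq⟩

/-- Two critical sets that meet give an ear: follow the path from `T` until it first enters `X`,
and continue inside `X` to `S`. -/
theorem CriticalOver.hasEar_of_mem [Finite V] (hm : G.IsPartnerMap m) {S T X Y : Set V}
    (hX : G.CriticalOver m S X) (hY : G.CriticalOver m T Y) {u : V} (huX : u ∈ X) (huY : u ∈ Y) :
    G.HasEar S T (X ∪ Y) := by
  have hXc := hX.closed
  have hYc := hY.closed
  obtain ⟨p, hp, t, ht, htp, hup⟩ := hY.exists_exit u huY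
  by_cases hpX : p ∈ X
  · obtain ⟨q, hq, s, hs, hsq, hpq⟩ := hX.exists_exit p hpX
    exact HasEar.mono hm hXc (by grind) Set.subset_union_left
      ⟨q, hq, p, hpX, ⟨s, hs, hsq⟩, ⟨t, ht, htp⟩, hpq.symm⟩
  · have hYX : ∀ v ∈ Y \ X, m v ∈ Y \ X := by
      intro v hv
      have := hXc (m v)
      have := (hm v).2
      grind
    obtain ⟨a, haU, hap, ha, W, hWU, hW⟩ :=
      hm.exists_alternatingSet hYX hup.2 ⟨hp, hpX⟩ (by simp)
    obtain ⟨r, hrX, har⟩ : ∃ r ∈ X, G.Adj a r := by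
      rcases ha with ha | ⟨r, hr, hrY, har⟩
      · grind
      · exact ⟨r, by grind, har⟩
    obtain ⟨q, hq, s, hs, hsq, hrq⟩ := hX.exists_exit r hrX
    have hl := hW.left_mem
    have hpq := hW.ends.splice hrq (fun v hv => (hWU hv).2) hl hW.right_mem hrX hq har
    have hWc := hW.closed
    exact HasEar.mono hm (by grind) (by grind) (by grind)
      ⟨q, .inr hq, p, .inl hl, ⟨s, hs, hsq⟩, ⟨t, ht, htp⟩, hpq.symm⟩

theorem CriticalOver.hasEar_of_adj {S T X Y : Set V} (hX : G.CriticalOver m S X)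
    (hY : G.CriticalOver m T Y) (hXY : ∀ v ∈ X, v ∉ Y) {u w : V} (hu : u ∈ X) (hw : w ∈ Y)
    (huw : G.Adj u w) : G.HasEar S T (X ∪ Y) := by
  obtain ⟨p, hp, s, hs, hsp, hup⟩ := hX.exists_exit u hu
  obtain ⟨q, hq, t, ht, htq, hwq⟩ := hY.exists_exit w hw
  exact ⟨p, .inl hp, q, .inr hq, ⟨s, hs, hsp⟩, ⟨t, ht, htq⟩,
    hup.symm.splice hwq hXY hp hu hw hq huw⟩

theorem JointlyExposable.hasEar_of_attached {S T X Y W : Set V} {e e' : V}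
    (hW : G.JointlyExposable W e e') (he : e ∈ W) (he' : e' ∈ W) (hXY : ∀ v ∈ X, v ∉ Y)
    (hWX : ∀ v ∈ W, v ∉ X) (hWY : ∀ v ∈ W, v ∉ Y) (hS : G.Attached S X e)
    (hT : G.Attached T Y e') : G.HasEar S T (X ∪ Y ∪ W) := by
  obtain ⟨p, hp, hs, hpm⟩ := hS
  obtain ⟨q, hq, ht, hqm⟩ := hT
  have := hW.1
  refine ⟨p, by grind, q, by grind, hs, ht, by grind,
    (hpm.union hW.2 (C := (X ∪ W) \ {p, e'}) ?_ ?_).union hqm ?_ ?_⟩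
  all_goals grind

/-- Every vertex outside `X` and `Y` starts an alternating path to a vertex attached to one of
them. -/
theorem CriticalOver.exists_attached [Finite V] (hm : G.IsPartnerMap m) {S T X Y K : Set V}
    (hK : G.CriticalOver m (S ∪ T) K) (hX : G.CriticalOver m S X) (hY : G.CriticalOver m T Y)
    {u : V} (hu : u ∈ K \ (X ∪ Y)) :
    ∃ z ∈ K \ (X ∪ Y), (G.Attached S X z ∨ G.Attached T Y z) ∧
      ∃ W ⊆ K \ (X ∪ Y), G.AlternatingSet m W u z := by
  have hR : ∀ v ∈ K \ (X ∪ Y), m v ∈ K \ (X ∪ Y) := by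
    intro v hv
    have := hX.closed (m v)
    have := hY.closed (m v)
    have := hK.closed v
    have := (hm v).2
    grind
  obtain ⟨p, hp, g, hg, hgp, hup⟩ := hK.exists_exit u hu.1
  obtain ⟨z, hzU, hzu, hz, W, hWU, hW⟩ := hm.exists_alternatingSet hR hup.2 hu (by simp)
  refine ⟨z, hzU, ?_, W, hWU, hW⟩
  have : ∃ r, ((r ∈ S ∨ r ∈ X) ∨ (r ∈ T ∨ r ∈ Y)) ∧ G.Adj r z := by
    by_cases hzp : z = p
    · exact ⟨g, by grind, hzp ▸ hgp⟩
    · obtain ⟨r, hrK, hrR, hzr⟩ := hz.resolve_left (by grind)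
      exact ⟨r, by grind, hzr.symm⟩
  obtain ⟨r, hr | hr, hrz⟩ := this
  · exact .inl (hX.attached hm (by grind) ⟨r, hr, hrz⟩)
  · exact .inr (hY.attached hm (by grind) ⟨r, hr, hrz⟩)

theorem exists_maximal_criticalOver [Finite V] (G : SimpleGraph V) (m : V → V) (S K : Set V) :
    ∃ X ⊆ K, G.CriticalOver m S X ∧
      ∀ W ⊆ K, G.CriticalOver m S (X ∪ W) → W ⊆ X := by
  obtain ⟨X, hX⟩ := (Set.toFinite {X | G.CriticalOver m S X ∧ X ⊆ K}).exists_maximal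
    ⟨∅, ⟨by simp, by simp⟩, by simp⟩
  exact ⟨X, hX.1.2, hX.1.1, fun W hW h => Set.subset_union_right.trans
    (hX.2 ⟨h, Set.union_subset hX.1.2 hW⟩ Set.subset_union_left)⟩

/-- If `K` is critical over `S ∪ T` and has no ear from `S` to `T`, then `K` splits into two parts
without edges between them, one having no neighbor in `T` and the other none in `S`. The parts are
largest subsets critical over `S` and over `T`: a vertex outside both would lie on an alternating
path that enlarges one of them or connects `S` to `T`. -/
theorem CriticalOver.exists_split [Finite V] (hm : G.IsPartnerMap m) {S T K : Set V}
    (hK : G.CriticalOver m (S ∪ T) K) (hear : ¬ G.HasEar S T K) :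
    ∃ X Y : Set V, K = X ∪ Y ∧ (∀ u ∈ X, ∀ w ∈ Y, ¬ G.Adj u w) ∧
      (∀ u ∈ X, ∀ t ∈ T, ¬ G.Adj t u) ∧ (∀ u ∈ Y, ∀ s ∈ S, ¬ G.Adj s u) := by
  obtain ⟨X, hXK, hX, hXmax⟩ := exists_maximal_criticalOver G m S K
  obtain ⟨Y, hYK, hY, hYmax⟩ := exists_maximal_criticalOver G m T K
  have hXYK := Set.union_subset hXK hYK
  have hXYc : ∀ v ∈ X ∪ Y, m v ∈ X ∪ Y := fun v hv => hv.imp (hX.closed v) (hY.closed v)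
  have hdisj : ∀ u ∈ X, u ∉ Y := fun u huX huY =>
    hear ((hX.hasEar_of_mem hm hY huX huY).mono hm hXYc hK.closed hXYK)
  refine ⟨X, Y, ?_, fun u hu w hw huw => ?_, fun u hu t ht htu => ?_, fun u hu s hs hsu => ?_⟩
  · by_contra hne
    obtain ⟨u, hu⟩ : ∃ u, u ∈ K \ (X ∪ Y) := by
      by_contra! h
      exact hne (Set.Subset.antisymm (fun u hu => by_contra fun h' => h u ⟨hu, h'⟩) hXYK)
    obtain ⟨e, heU, he, -⟩ := hK.exists_attached hm hX hY hu
    obtain ⟨e', heU', he', W, hWU, hW⟩ := hK.exists_attached hm hX hY heU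
    have hl := hW.left_mem
    have hr := hW.right_mem
    have hWK : W ⊆ K := fun v hv => (hWU hv).1
    have hWX : ∀ v ∈ W, v ∉ X := fun v hv h => (hWU hv).2 (.inl h)
    have hWY : ∀ v ∈ W, v ∉ Y := fun v hv h => (hWU hv).2 (.inr h)
    have hc : ∀ v ∈ X ∪ Y ∪ W, m v ∈ X ∪ Y ∪ W := fun v hv => hv.imp (hXYc v) (hW.closed v)
    rcases he with he | he <;> rcases he' with he' | he'
    · exact hWX e hl (hXmax W hWK (hX.union_alternatingSet hm hW hWX he he') hl)
    · exact hear ((hW.ends.hasEar_of_attached hl hr hdisj hWX hWY he he').mono hm hc hK.closed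
        (Set.union_subset hXYK hWK))
    · exact hear ((hW.ends.symm.hasEar_of_attached hr hl hdisj hWX hWY he' he).mono hm hc
        hK.closed (Set.union_subset hXYK hWK))
    · exact hWY e hl (hYmax W hWK (hY.union_alternatingSet hm hW hWY he he') hl)
  · exact hear ((hX.hasEar_of_adj hY hdisj hu hw huw).mono hm hXYc hK.closed hXYK)
  · obtain ⟨p, hp, s, hs, hsp, hup⟩ := hX.exists_exit u hu
    exact hear (HasEar.mono hm hX.closed hK.closed hXK
      ⟨p, hp, u, hu, ⟨s, hs, hsp⟩, ⟨t, ht, htu⟩, hup.symm⟩)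
  · obtain ⟨p, hp, t, ht, htp, hup⟩ := hY.exists_exit u hu
    exact hear (HasEar.mono hm hY.closed hK.closed hYK
      ⟨u, hu, p, hp, ⟨s, hs, hsu⟩, ⟨t, ht, htp⟩, hup⟩)

end Coloring

/-! ### The Gallai–Edmonds partition of a vertex-deleted subgraph -/

section GallaiEdmonds

variable {V : Type*} {G : SimpleGraph V}

theorem matchableOn_induce_iff {X : Set V} {T : Set X} :
    (G.induce X).MatchableOn T ↔ G.MatchableOn ((↑) '' T) := by
  classical
  constructor
  · rintro ⟨f, hf⟩
    refine ⟨fun v => if h : v ∈ X then f ⟨v, h⟩ else v, ?_⟩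
    rintro _ ⟨v, hv, rfl⟩
    obtain ⟨h1, h2, h3⟩ := hf v hv
    simp only [Subtype.coe_prop, dif_pos, Subtype.coe_eta, h3, and_true]
    exact ⟨⟨_, h1, rfl⟩, h2⟩
  · rintro ⟨f, hf⟩
    refine ⟨fun v => if h : f v ∈ X then ⟨f v, h⟩ else v, fun v hv => ?_⟩
    obtain ⟨⟨w, hw, hwv⟩, h2, h3⟩ := hf v ⟨v, hv, rfl⟩
    have hX : f v ∈ X := hwv ▸ w.2
    obtain rfl : w = ⟨f v, hX⟩ := Subtype.ext hwv
    simp only [hX, dif_pos, h3, Subtype.coe_prop, Subtype.coe_eta, and_true]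
    exact ⟨hw, h2⟩

theorem factorizable_iff_matchableOn_univ : G.Factorizable ↔ G.MatchableOn Set.univ := by
  rw [factorizable_iff_exists_isPartnerMap]
  exact ⟨fun ⟨m, hm⟩ => hm.matchableOn fun _ _ => trivial,
    fun ⟨m, hm⟩ => ⟨m, fun v => (hm v trivial).2⟩⟩

theorem factorizable_induce_iff {S : Set V} : (G.induce S).Factorizable ↔ G.MatchableOn S := by
  rw [factorizable_iff_matchableOn_univ, matchableOn_induce_iff, Set.image_univ,
    Subtype.range_coe]

theorem Subgraph.IsMatching.matchableOn_verts {M : G.Subgraph} (hM : M.IsMatching) :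
    G.MatchableOn M.verts := by
  classical
  choose! f hf using fun v (hv : v ∈ M.verts) => (hM hv).exists
  exact ⟨f, fun v hv => ⟨(hf v hv).snd_mem, (hf v hv).adj_sub,
    hM.eq_of_adj_left (hf _ (hf v hv).snd_mem) (hf v hv).symm⟩⟩

theorem MatchableOn.exists_isMatching {S : Set V} (h : G.MatchableOn S) :
    ∃ M : G.Subgraph, M.IsMatching ∧ M.verts = S := by
  obtain ⟨f, hf⟩ := h
  refine ⟨⟨S, fun u v => u ∈ S ∧ f u = v, ?_, fun h => h.1, ⟨?_⟩⟩, ?_, rfl⟩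
  · rintro u v ⟨hu, rfl⟩
    exact (hf u hu).2.1
  · rintro u v ⟨hu, rfl⟩
    exact ⟨(hf u hu).1, (hf u hu).2.2⟩
  · exact fun v hv => ⟨f v, ⟨hv, rfl⟩, fun _ h => h.2.symm⟩

theorem Subgraph.IsMatching.ncard_verts [Finite V] {M : G.Subgraph} (hM : M.IsMatching) :
    M.verts.ncard = 2 * M.edgeSet.ncard := by
  classical
  have := Fintype.ofFinite V
  have h := M.spanningCoe.sum_degrees_eq_twice_card_edges
  have hdeg : ∀ v, M.spanningCoe.degree v = if v ∈ M.verts then 1 else 0 := by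
    intro v
    rw [Subgraph.degree_spanningCoe]
    split_ifs with hv
    · exact (Subgraph.isMatching_iff_forall_degree.1 hM) v hv
    · exact Subgraph.degree_of_notMem_verts hv
  simp only [hdeg, Finset.sum_boole, Nat.cast_id] at h
  rw [Set.ncard_eq_toFinset_card', Set.ncard_eq_toFinset_card']
  convert h using 2
  · ext; simp
  · congr 1; ext; simp [mem_edgeFinset]

/-- If some vertex-deleted subgraph has a perfect matching, then the maximum matchings are the
perfect matchings of the vertex-deleted subgraphs. -/
theorem mem_gallaiEdmondsD_iff_matchableOn [Finite V] {p : V} (hp : G.MatchableOn {p}ᶜ) {v : V} :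
    v ∈ G.gallaiEdmondsD ↔ G.MatchableOn {v}ᶜ := by
  have hcard := fun a : V => Set.ncard_compl ({a} : Set V)
  simp only [Set.ncard_singleton] at hcard
  constructor
  · rintro ⟨M, ⟨hM, hmax⟩, hv⟩
    obtain ⟨N, hN, hNp⟩ := hp.exists_isMatching
    have h1 := hmax N hN
    have h2 := hM.ncard_verts
    have h3 := hN.ncard_verts
    rw [hNp, hcard] at h3
    have h4 : M.verts = {v}ᶜ := Set.eq_of_subset_of_ncard_le
      (fun a ha h => hv (h ▸ ha)) (by rw [hcard]; omega)
    exact h4 ▸ hM.matchableOn_verts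
  · intro h
    obtain ⟨M, hM, hMv⟩ := h.exists_isMatching
    refine ⟨M, ⟨hM, fun N hN => ?_⟩, by simp [hMv]⟩
    have h1 := hN.ncard_verts
    have h2 := hM.ncard_verts
    rw [hMv, hcard] at h2
    have h3 := Set.ncard_le_card N.verts
    -- The number of vertices of `G` is odd, so every matching misses at least one of them.
    omega

theorem mem_gallaiEdmondsD_induce_compl [Finite V] (hG : G.Factorizable) {x : V}
    {v : ({x}ᶜ : Set V)} :
    v ∈ (G.induce {x}ᶜ).gallaiEdmondsD ↔ G.JointlyExposable Set.univ x v := by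
  obtain ⟨m, hm⟩ := factorizable_iff_exists_isPartnerMap.1 hG
  have himage : ∀ v : ({x}ᶜ : Set V),
      ((↑) '' ({v}ᶜ : Set ({x}ᶜ : Set V)) : Set V) = Set.univ \ {x, (v : V)} := by
    rintro ⟨v, hv⟩
    ext a
    simp
  have hx := hm.jointlyExposable (U := Set.univ) (fun _ _ => trivial) x
  rw [mem_gallaiEdmondsD_iff_matchableOn (p := ⟨m x, hx.1.symm⟩)
    (by rw [matchableOn_induce_iff, himage]; exact hx.2), matchableOn_induce_iff, himage]
  exact ⟨fun h => ⟨fun h' => v.2 h'.symm, h⟩, fun h => h.2⟩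

/-- `C(G - x)` consists of the vertices that neither are jointly exposable with `x` nor have a
neighbor which is. -/
theorem mem_image_gallaiEdmondsC_iff [Finite V] (hG : G.Factorizable) {x v : V} :
    v ∈ ((↑) : ({x}ᶜ : Set V) → V) '' (G.induce {x}ᶜ).gallaiEdmondsC ↔
      v ≠ x ∧ ¬ G.JointlyExposable Set.univ x v ∧
        ∀ w, G.Adj v w → ¬ G.JointlyExposable Set.univ x w := by
  constructor
  · rintro ⟨v, hv, rfl⟩
    simp only [gallaiEdmondsC, gallaiEdmondsA, Set.mem_compl_iff, Set.mem_union, not_or,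
      Set.mem_ofPred_eq, not_and, not_exists, mem_gallaiEdmondsD_induce_compl hG] at hv
    exact ⟨v.2, hv.1, fun w hvw hw => hv.2 hv.1 ⟨w, hw.1.symm⟩ hw hvw⟩
  · rintro ⟨hvx, hv, hadj⟩
    refine ⟨⟨v, hvx⟩, ?_, rfl⟩
    simp only [gallaiEdmondsC, gallaiEdmondsA, Set.mem_compl_iff, Set.mem_union, not_or,
      Set.mem_ofPred_eq, not_and, not_exists, mem_gallaiEdmondsD_induce_compl hG]
    exact ⟨hv, fun _ w hw hvw => hadj w hvw hw⟩

end GallaiEdmonds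

/-! ### Factor-critical contractions -/

section Contraction

variable {V : Type*} {G : SimpleGraph V}

theorem connectedComponentMk_induce_spanningCoe_eq_iff {S : Set V}
    (hS : ∀ a ∈ S, ∀ b ∈ S, (G.induce S).spanningCoe.Reachable a b) {a b : V} :
    (G.induce S).spanningCoe.connectedComponentMk a =
      (G.induce S).spanningCoe.connectedComponentMk b ↔ a = b ∨ a ∈ S ∧ b ∈ S := by
  rw [ConnectedComponent.eq]
  constructor
  · intro h
    rw [reachable_iff_reflTransGen] at h
    induction h with
    | refl => exact .inl rfl
    | tail _ h ih =>
      simp only [map_adj, comap_adj, Function.Embedding.subtype_apply] at h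
      obtain ⟨c, d, -, rfl, rfl⟩ := h
      have := c.2
      have := d.2
      grind
  · rintro (rfl | ⟨ha, hb⟩)
    · exact .rfl
    · exact hS a ha b hb

/-- A perfect matching of `G / S` minus a vertex outside `S` matches the contracted vertex along an
edge that leaves `S`. -/
theorem FactorCritical.exists_exit {S : Set V} (hS : ∀ a ∈ S, ∀ b ∈ S,
    (G.induce S).spanningCoe.Reachable a b) (hfc : (G.contract S).FactorCritical)
    (hne : S.Nonempty) {x : V} (hx : x ∉ S) :
    ∃ p ∈ Sᶜ, ∃ s ∈ S, G.Adj s p ∧ G.JointlyExposable Sᶜ x p := by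
  obtain ⟨c, hc⟩ := hne
  set κ := (G.induce S).spanningCoe.connectedComponentMk with hκ
  have hκ_eq : ∀ a b, κ a = κ b ↔ a = b ∨ a ∈ S ∧ b ∈ S := fun a b =>
    connectedComponentMk_induce_spanningCoe_eq_iff hS
  have hadj : ∀ a b, (G.contract S).Adj (κ a) (κ b) ↔
      κ a ≠ κ b ∧ ∃ u, κ u = κ a ∧ ∃ v, κ v = κ b ∧ G.Adj u v := fun a b => Iff.rfl
  obtain ⟨f, hf⟩ := factorizable_induce_iff.1 (hfc (κ x))
  have hκ_surj : ∀ c, ∃ v, κ v = c := fun c => Quot.exists_rep c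
  choose ρ hρ using hκ_surj
  have hcx : κ c ≠ κ x := by grind
  obtain ⟨h1, h2, h3⟩ := hf (κ c) hcx
  rw [← hρ (f (κ c)), hadj, hρ] at h2
  obtain ⟨hne, s, hs, p, hp, hsp⟩ := h2
  have hsS : s ∈ S := by grind
  have hpS : p ∉ S := by grind
  have hxp : x ≠ p := by
    rintro rfl
    exact h1 hp.symm
  refine ⟨p, hpS, s, hsS, hsp, hxp, fun v => ρ (f (κ v)), fun v hv => ?_⟩
  beta_reduce
  have hvS : v ∉ S := hv.1
  have hvx : v ≠ x := by grind
  have hvp : v ≠ p := by grind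
  have hvx' : κ v ≠ κ x := by grind
  obtain ⟨k1, k2, k3⟩ := hf (κ v) hvx'
  have hr := hρ (f (κ v))
  have hrS : ρ (f (κ v)) ∉ S := by
    intro h
    have : f (κ v) = κ c := by rw [← hr, hκ_eq]; exact .inr ⟨h, hc⟩
    rw [this, ← hp, hκ_eq] at k3
    grind
  rw [← hr, hadj] at k2
  obtain ⟨-, u, hu, w, hw, huw⟩ := k2
  rw [hκ_eq] at hu hw
  obtain rfl : u = v := by grind
  obtain rfl : w = ρ (f (κ u)) := by grind
  refine ⟨⟨hrS, ?_⟩, huw, ?_⟩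
  · rintro (h | h)
    · exact k1 (by rw [← hr, h]; rfl)
    · have : f (κ u) = f (κ c) := by rw [← hr, ← hp, Set.mem_singleton_iff.1 h]
      rw [this, h3, hκ_eq] at k3
      grind
  · have := hρ (f (κ (ρ (f (κ u)))))
    rw [hr, k3, hκ_eq] at this
    rw [hr, k3]
    grind

end Contraction

/-! ### The minimum component -/

section MinimumComponent

variable {V : Type*} {G : SimpleGraph V} {m : V → V}

theorem IsPartnerMap.allowedGraph_adj (hm : G.IsPartnerMap m) (v : V) :
    G.allowedGraph.Adj v (m v) :=
  allowedGraph_adj_iff.2 ⟨m, hm, rfl⟩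

theorem JointlyExposable.allowedGraph_adj {a b : V} (hab : G.Adj a b)
    (h : G.JointlyExposable Set.univ a b) : G.allowedGraph.Adj a b := by
  classical
  obtain ⟨f, hf⟩ := h.2
  refine allowedGraph_adj_iff.2
    ⟨fun v => if v = a then b else if v = b then a else f v, fun v => ?_, by simp⟩
  have := hf v
  have := h.1
  have := hab.symm
  grind

theorem IsSeparating.closed {X : Set V} (hX : G.IsSeparating X) (hm : G.IsPartnerMap m) {v : V}
    (hv : v ∈ X) : m v ∈ X := by
  rcases hX _ ⟨G.allowedGraph.connectedComponentMk v, rfl⟩ with h | h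
  · exact h (ConnectedComponent.sound (hm.allowedGraph_adj v).reachable.symm)
  · exact absurd ⟨ConnectedComponent.connectedComponentMk_mem, hv⟩
      (Set.eq_empty_iff_forall_notMem.1 h v)

theorem ConnectedComponent.closed_of_isPartnerMap (K : G.allowedGraph.ConnectedComponent)
    (hm : G.IsPartnerMap m) {v : V} (hv : v ∈ K.supp) : m v ∈ K.supp :=
  (ConnectedComponent.sound (hm.allowedGraph_adj v).reachable.symm).trans hv

/-- The vertex set of a factor-connected component is connected, so contracting its edges produces
a single vertex. -/
theorem reachable_contract_of_supp_subset (K : G.allowedGraph.ConnectedComponent) {X : Set V}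
    (hKX : K.supp ⊆ X) (a b : X) (ha : (a : V) ∈ K.supp) (hb : (b : V) ∈ K.supp) :
    ((G.induce X).induce ((↑) ⁻¹' K.supp)).spanningCoe.Reachable a b := by
  have h : G.allowedGraph.Reachable a b := ConnectedComponent.exact (ha.trans hb.symm)
  have key : ∀ c, G.allowedGraph.Reachable a c → ∀ hc : c ∈ X,
      ((G.induce X).induce ((↑) ⁻¹' K.supp)).spanningCoe.Reachable a ⟨c, hc⟩ := by
    intro c h
    rw [reachable_iff_reflTransGen] at h
    induction h with
    | refl => exact fun _ => .rfl
    | @tail c d hac hcd ih =>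
      intro hd
      have hcK : c ∈ K.supp :=
        (ConnectedComponent.sound ((reachable_iff_reflTransGen _ _).2 hac).symm).trans ha
      have hdK : d ∈ K.supp := (ConnectedComponent.sound hcd.reachable.symm).trans hcK
      refine (ih (hKX hcK)).trans (Adj.reachable ?_)
      simp only [map_adj, comap_adj, Function.Embedding.subtype_apply]
      obtain ⟨M, -, hM⟩ := hcd
      exact ⟨⟨⟨c, hKX hcK⟩, hcK⟩, ⟨⟨d, hd⟩, hdK⟩, hM.adj_sub, rfl, rfl⟩
  exact key b h b.2

/-- If the component `K` yields every component, then the complement of `K` is critical over it. -/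
theorem criticalOver_compl_supp (hm : G.IsPartnerMap m) (K : G.allowedGraph.ConnectedComponent)
    (hmin : ∀ H ∈ G.factorComponents, G.Yields ((⊤ : G.Subgraph).induce K.supp) H) :
    G.CriticalOver m K.supp K.suppᶜ := by
  have hKc : ∀ v ∈ K.suppᶜ, m v ∈ K.suppᶜ := fun v hv h =>
    hv ((hm v).2 ▸ K.closed_of_isPartnerMap hm h)
  refine ⟨hKc, fun u hu => ?_⟩
  obtain ⟨X, hX, hsub, hfc⟩ := hmin _ ⟨G.allowedGraph.connectedComponentMk u, rfl⟩
  simp only [Subgraph.induce_verts, Set.union_subset_iff] at hsub hfc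
  obtain ⟨hKX, huX⟩ := hsub
  obtain ⟨c, hc⟩ := K.nonempty_supp
  obtain ⟨p, hp, s, hs, hsp, hup⟩ := hfc.exists_exit (x := ⟨u, huX rfl⟩)
    (fun a ha b hb => reachable_contract_of_supp_subset K hKX a b ha hb) ⟨⟨c, hKX hc⟩, hc⟩ hu
  refine ⟨p, hp, s, hs, hsp, ?_⟩
  have : G.JointlyExposable (X \ K.supp) u p := by
    refine ⟨fun h => hup.1 (Subtype.ext h), (matchableOn_induce_iff.1 hup.2).congr fun a => ?_⟩
    simp only [Set.mem_sdiff, Set.mem_insert_iff, Set.mem_singleton_iff, Set.mem_image,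
      Set.mem_compl_iff, Set.mem_preimage, Subtype.exists, Subtype.ext_iff]
    grind
  exact this.mono (W := X \ K.supp) hm hKc (fun v hv => ⟨hX.closed hm hv.1, hKc v hv.2⟩)
    (fun v hv => hv.2) ⟨huX rfl, hu⟩ ⟨p.2, hp⟩

/-- The vertices reachable from `v` by walks whose later vertices lie outside `S`; for `v ∉ S` this
is the vertex set of the connected component of `v` in `G - S`. -/
def reachableOutside (G : SimpleGraph V) (S : Set V) (v : V) : Set V :=
  {w | Relation.ReflTransGen (fun a b => G.Adj a b ∧ b ∉ S) v w}

theorem mem_reachableOutside_self {S : Set V} {v : V} : v ∈ G.reachableOutside S v :=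
  Relation.ReflTransGen.refl

theorem mem_reachableOutside_of_adj {S : Set V} {v a b : V} (ha : a ∈ G.reachableOutside S v)
    (hab : G.Adj a b) (hb : b ∉ S) : b ∈ G.reachableOutside S v :=
  Relation.ReflTransGen.tail ha ⟨hab, hb⟩

theorem reachableOutside_subset {S C : Set V} {v : V} (hv : v ∈ C)
    (hC : ∀ a ∈ C, ∀ b ∉ S, a ∈ G.reachableOutside S v → G.Adj a b → b ∈ C) :
    G.reachableOutside S v ⊆ C := by
  intro w hw
  have : w ∈ G.reachableOutside S v ∧ w ∈ C := by
    induction hw with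
    | refl => exact ⟨mem_reachableOutside_self, hv⟩
    | tail _ h ih =>
      exact ⟨mem_reachableOutside_of_adj ih.1 h.1 h.2, hC _ ih.2 _ h.2 ih.1 h.1⟩
  exact this.2

theorem CriticalOver.reachableOutside [Finite V] (hm : G.IsPartnerMap m) {S : Set V}
    (hS : G.CriticalOver m S Sᶜ) {v : V} (hv : v ∉ S) :
    G.CriticalOver m S (G.reachableOutside S v) := by
  have hsub : G.reachableOutside S v ⊆ Sᶜ :=
    reachableOutside_subset hv fun _ _ b hb _ _ => hb
  have hcl : ∀ u ∈ G.reachableOutside S v, m u ∈ G.reachableOutside S v := fun u hu =>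
    mem_reachableOutside_of_adj hu (hm u).1 (hS.closed u (hsub hu))
  refine ⟨hcl, fun u hu => ?_⟩
  obtain ⟨p, hp, s, hs, hsp, hup⟩ := hS.exists_exit u (hsub hu)
  obtain ⟨z, hz, hzu, hz', W, hWU, hW⟩ := hm.exists_alternatingSet hcl hup.2 hu (by simp)
  obtain rfl : z = p := by
    rcases hz' with h | ⟨r, hr, hr', hzr⟩
    · have := hsub hz
      grind
    · exact absurd (mem_reachableOutside_of_adj hz hzr hr.1) hr'
  exact ⟨z, hz, s, hs, hsp, hW.ends.mono hm hcl hW.closed hWU hW.left_mem hW.right_mem⟩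

/-- Let `L` be a connected component of `G - K` for a factor-connected component `K` over which the
outside is critical. Then any two neighbors of `L` in `K` fail to be jointly exposable in `G - L`:
otherwise some ear through `L` would join two such vertices, and would complete to a perfect
matching of `G` containing an edge between `K` and `L`. -/
theorem not_jointlyExposable_of_adj_reachableOutside [Finite V] (hG : G.Factorizable)
    (K : G.allowedGraph.ConnectedComponent) (hm : G.IsPartnerMap m)
    (hK : G.CriticalOver m K.supp K.suppᶜ) {v x y k l : V} (hv : v ∉ K.supp) (hx : x ∈ K.supp)
    (hy : y ∈ K.supp) (hk : k ∈ G.reachableOutside K.supp v)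
    (hl : l ∈ G.reachableOutside K.supp v) (hxk : G.Adj x k) (hyl : G.Adj y l) :
    ¬ G.JointlyExposable (G.reachableOutside K.supp v)ᶜ x y := by
  intro hxy
  have hcrit := hK.reachableOutside hm hv
  have hind := fun C => reachableOutside_subset (G := G) (S := K.supp) (C := C) (v := v)
  have hself : v ∈ G.reachableOutside K.supp v := mem_reachableOutside_self
  have hL : ∀ u ∈ G.reachableOutside K.supp v, u ∉ K.supp :=
    reachableOutside_subset (C := K.suppᶜ) hv fun _ _ b hb _ _ => hb
  have hadj : ∀ a ∈ G.reachableOutside K.supp v, ∀ b ∉ K.supp, G.Adj a b →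
      b ∈ G.reachableOutside K.supp v := fun a ha b hb hab => mem_reachableOutside_of_adj ha hab hb
  generalize G.reachableOutside K.supp v = L at *
  have hsep : ∀ m, G.IsPartnerMap m → ∀ u ∈ Lᶜ, m u ∈ Lᶜ := by
    intro n hn u hu hnu
    have huK : u ∉ K.supp := fun h => hL _ hnu (K.closed_of_isPartnerMap hn h)
    exact hu (hadj _ hnu u huK (hn u).1.symm)
  have hKL : ∀ u ∈ K.supp, u ∈ Lᶜ := fun u hu h => hL u h hu
  have hreach : ∀ a ∈ K.supp, ∀ b ∈ K.supp, G.allowedGraph.Reachable a b := fun a ha b hb =>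
    ConnectedComponent.exact (Eq.trans ha (Eq.symm hb))
  let S : Set V := {s | s ∈ K.supp ∧ ¬ G.JointlyExposable Lᶜ x s}
  let T : Set V := {t | t ∈ K.supp ∧ G.JointlyExposable Lᶜ x t}
  have hST : S ∪ T = K.supp := by
    ext a
    simp only [S, T, Set.mem_union, Set.mem_ofPred_eq]
    tauto
  have hxS : x ∈ S := ⟨hx, fun h => h.1 rfl⟩
  have hyT : y ∈ T := ⟨hy, hxy⟩
  have hear : ¬ G.HasEar S T L := by
    rintro ⟨p, hp, q, hq, ⟨s, hs, hsp⟩, ⟨t, ht, htq⟩, hpq⟩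
    have hst : G.JointlyExposable Lᶜ s t := by
      by_contra hst
      exact not_jointlyExposable_trans hG hsep (hKL x hx) (hKL s hs.1) (hreach s hs.1 x hx)
        hs.2 hst ht.2
    have hsp' := hst.splice hpq.symm (fun _ h => h) (hKL s hs.1) (hKL t ht.1) hq hp htq
    rw [Set.compl_union_self] at hsp'
    exact hL p hp ((ConnectedComponent.sound
      (hsp'.allowedGraph_adj hsp).reachable.symm).trans hs.1)
  obtain ⟨A, B, rfl, hAB, hAT, hBS⟩ := (hST ▸ hcrit).exists_split hm hear
  -- `L` is connected, so it coincides with the part containing `v`; but it has neighbors in both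
  -- color classes.
  rcases hself with h | h
  · have hsub := hind A h fun a ha b hb hL hab =>
      (hadj a hL b hb hab).resolve_right fun h => hAB a ha b h hab
    exact hAT l (hsub hl) y hyT hyl
  · have hsub := hind B h fun a ha b hb hL hab =>
      (hadj a hL b hb hab).resolve_left fun h => hAB b h a ha hab.symm
    exact hBS k (hsub hk) x hxS hxk

/-- Every vertex outside the minimum component lies in `C(G - x)` for some `x`: take for `x` a
neighbor, in the minimum component, of the component of that vertex in the rest of `G`. -/
theorem exists_mem_gallaiEdmondsC [Finite V] (hG : G.Factorizable)
    (K : G.allowedGraph.ConnectedComponent) (hm : G.IsPartnerMap m)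
    (hK : G.CriticalOver m K.supp K.suppᶜ) {v : V} (hv : v ∉ K.supp) :
    ∃ x, v ∈ ((↑) : ({x}ᶜ : Set V) → V) '' (G.induce {x}ᶜ).gallaiEdmondsC := by
  have hcrit := hK.reachableOutside hm hv
  have hself : v ∈ G.reachableOutside K.supp v := mem_reachableOutside_self
  have hL : ∀ u ∈ G.reachableOutside K.supp v, u ∉ K.supp :=
    reachableOutside_subset (C := K.suppᶜ) hv fun _ _ b hb _ _ => hb
  have hadj : ∀ a ∈ G.reachableOutside K.supp v, ∀ b, G.Adj a b →
      b ∈ G.reachableOutside K.supp v ∨ b ∈ K.supp := fun a ha b hab =>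
    or_iff_not_imp_right.2 fun hb => mem_reachableOutside_of_adj ha hab hb
  obtain ⟨k, hk, x, hx, hxk, -⟩ := hcrit.exists_exit v hself
  have hno := fun y l hy hl hyl => not_jointlyExposable_of_adj_reachableOutside (y := y) (l := l)
    hG K hm hK hv hx hy hk hl hxk hyl
  generalize G.reachableOutside K.supp v = L at *
  have hcl : ∀ u ∈ Lᶜ, m u ∈ Lᶜ := fun u hu h => hu ((hm u).2 ▸ hcrit.closed _ h)
  have hxL : x ∈ Lᶜ := fun h => hL x h hx
  have key : ∀ u, u ∈ L ∨ (u ∈ K.supp ∧ ∃ l ∈ L, G.Adj u l) →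
      ¬ G.JointlyExposable Set.univ x u := by
    intro u hu hxu
    obtain ⟨z, hz, hzx, hz', W, hWL, hW⟩ := hm.exists_alternatingSet hcl hxu.2 hxL (by simp)
    have hxz := hW.ends.mono hm hcl hW.closed hWL hW.left_mem hW.right_mem
    rcases hz' with h | ⟨r, -, hr, hzr⟩
    · obtain rfl : z = u := by
        by_contra hzu
        exact h ⟨trivial, by simp [hzx, hzu]⟩
      obtain ⟨hzK, l, hl, hzl⟩ := hu.resolve_left hz
      exact hno z l hzK hl hzl hxz
    · have hr : r ∈ L := not_not.1 hr
      exact hno z r ((hadj r hr z hzr.symm).resolve_left hz) hr hzr hxz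
  refine ⟨x, (mem_image_gallaiEdmondsC_iff hG).2 ⟨?_, key v (.inl hself), fun w hvw => key w ?_⟩⟩
  · rintro rfl
    exact hv hx
  · exact (hadj v hself w hvw).imp id fun hw => ⟨hw, v, hself, hvw.symm⟩

/-- A vertex of the minimum component lies in no `C(G - x)`. For `x` outside the component, a path
from `x` entering the component at `g` is continued by paths starting at `g` inside it. -/
theorem notMem_gallaiEdmondsC [Finite V] (hG : G.Factorizable)
    (K : G.allowedGraph.ConnectedComponent)
    (hK : G.CriticalOver m K.supp K.suppᶜ) {v : V} (hv : v ∈ K.supp) (x : V) :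
    v ∉ ((↑) : ({x}ᶜ : Set V) → V) '' (G.induce {x}ᶜ).gallaiEdmondsC := by
  rw [mem_image_gallaiEdmondsC_iff hG]
  rintro ⟨-, hxv, hadj⟩
  have hreach : ∀ a ∈ K.supp, G.allowedGraph.Reachable a v := fun a ha =>
    ConnectedComponent.exact (Eq.trans ha (Eq.symm hv))
  by_cases hx : x ∈ K.supp
  · rcases (jointlyExposable_or_adj_of_reachable hG (U := Set.univ) (fun _ _ _ _ => trivial)
      trivial (hreach x hx)).2 with h | ⟨w, -, hvw, h⟩
    · exact hxv h
    · exact hadj w hvw h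
  · obtain ⟨p, hp, g, hg, hgp, hxp⟩ := hK.exists_exit x hx
    have key : ∀ w ∈ K.supp, G.JointlyExposable K.supp g w →
        G.JointlyExposable Set.univ x w := fun w hw hgw => by
      have := hxp.splice hgw (fun _ h => h) hx hp hg hw hgp.symm
      rwa [Set.compl_union_self] at this
    rcases (jointlyExposable_or_adj_of_reachable hG
      (fun n hn u hu => K.closed_of_isPartnerMap hn hu) hg (hreach g hg)).2 with h | ⟨w, hw, hvw, h⟩
    · exact hxv (key v hv h)
    · exact hadj w hvw (key w hw h)

end MinimumComponent

end SimpleGraph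

theorem mainTheorem2 {V : Type*} [Finite V] (G : SimpleGraph V) (hG : G.Factorizable)
    (G₀ : G.Subgraph) (hG₀ : G₀ ∈ G.factorComponents)
    (hmin : ∀ H ∈ G.factorComponents, G.Yields G₀ H) :
    G₀.verts = Set.univ \ ⋃ x : V, ((↑) : ({x}ᶜ : Set V) → V) '' (G.induce {x}ᶜ).gallaiEdmondsC := by
  obtain ⟨K, rfl⟩ := hG₀
  obtain ⟨m, hm⟩ := SimpleGraph.factorizable_iff_exists_isPartnerMap.1 hG
  have hK := SimpleGraph.criticalOver_compl_supp hm K hmin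
  ext v
  rw [SimpleGraph.Subgraph.induce_verts, Set.mem_sdiff, Set.mem_iUnion]
  exact ⟨fun hv => ⟨trivial, fun ⟨x, hx⟩ => SimpleGraph.notMem_gallaiEdmondsC hG K hK hv x hx⟩,
    fun hv => by_contra fun hvK =>
      hv.2 (SimpleGraph.exists_mem_gallaiEdmondsC hG K hm hK hvK)⟩
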